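/- All manifolds are smooth, Hausdorff, second countable, connected and without boundary. **Setting.** Let $\mathcal N$ be a manifold of dimension $\mathfrak n$. *Null hypersurface data* $\{\mathcal N,\gamma,\boldsymbol\ell,\ell^{(2)},\mathbf Y\}$ consists of smooth fields on $\mathcal N$: a symmetric $(0,2)$-tensor $\gamma$ of signature $(0,+,\dots,+)$, a covector $\boldsymbol\ell$, a scalar $\ell^{(2)}$ and a symmetric $(0,2)$-tensor $\mathbf Y$, such that at every $p\in\mathcal N$ the symmetric bilinear form $$\mathcal A\big((W,a),(Z,b)\big)=\gamma(W,Z)+a\,\boldsymbol\ell(Z)+b\,\boldsymbol\ell(W)+ab\,\ell^{(2)}\qquad\text{on } T_p\mathcal N\times\mathbb R$$ is non-degenerate. Let $\overline\eta$ be a smooth vector field on $\mathcal N$ with $\gamma(\overline\eta,\cdot)=0$. The data is an *abstract Killing horizon of order zero* with symmetry generator $\overline\eta$ if the zero set of $\overline\eta$ has empty interior and $\pounds_{\overline\eta}\gamma=0$. Let $(\mathcal M,g)$ be a Lorentzian manifold of dimension $\mathfrak n+1$ and signature $(-,+,\dots,+)$. The data is *$\{\phi,\zeta\}$-embedded* in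 $(\mathcal M,g)$ if $\phi:\mathcal N\hookrightarrow\mathcal M$ is a smooth embedding and $\zeta$ is a smooth vector field along $\phi(\mathcal N)$, everywhere transverse to $\phi(\mathcal N)$, such that $$\phi^\star g=\gamma,\qquad \phi^\star(g(\zeta,\cdot))=\boldsymbol\ell,\qquad \phi^\star(g(\zeta,\zeta))=\ell^{(2)},\qquad \tfrac12\phi^\star(\pounds_\zeta g)=\mathbf Y .$$ (The last condition does not depend on how $\zeta$ is extended off $\phi(\mathcal N)$.) Let the data be an abstract Killing horizon of order zero with symmetry generator $\overline\eta$, $\{\phi,\zeta\}$-embedded in $(\mathcal M,g)$, and let $\eta$ be a smooth vector field on an open neighbourhood $\mathcal O\subset\mathcal M$ of $\phi(\mathcal N)$ with $\eta|_{\phi(\mathcal N)}=\phi_\star\overline\eta$. Then $\phi(\mathcal N)$, with $\eta$, is a *Killing horizon of order zero* if $$\phi^\star\big(g(\pounds_\zeta\eta,\zeta)\big)=-\tfrac12\pounds_{\overline\eta}\ell^{(2)},\qquad \phi^\star\big(g(\pounds_\zeta\eta,\cdot)\big)=-\pounds_{\overline\eta}\boldsymbol\ell\qquad\text{on }\mathcal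 N .$$ (Since $\eta$ is tangent to $\phi(\mathcal N)$, the vector $\pounds_\zeta\eta=[\zeta,\eta]$ on $\phi(\mathcal N)$ does not depend on how $\zeta$ is extended.) **Proposition.** On every Killing horizon of order zero, the deformation tensor $\mathcal K=\pounds_\eta g$ vanishes at every point of $\phi(\mathcal N)$: $\mathcal K_{\phi(p)}(v,w)=0$ for all $p\in\mathcal N$ and all $v,w\in T_{\phi(p)}\mathcal M$ (not only for those tangent to $\phi(\mathcal N)$). -/

import Mathlib

open Bundle Set Topology
open scoped Manifold ContDiff

noncomputable section

namespace HypersurfaceData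

section LieDerivative

variable {m : ℕ} {X : Type*} [TopologicalSpace X] [ChartedSpace (EuclideanSpace ℝ (Fin m)) X]
  [IsManifold (𝓡 m) ∞ X]

/-- The vector field `V` on `X` is smooth on the set `U`. -/
def SmoothVectorFieldOn (V : Π x : X, TangentSpace (𝓡 m) x) (U : Set X) : Prop :=
  ContMDiffOn (𝓡 m) (𝓡 m).tangent ∞ (fun x => (⟨x, V x⟩ : TangentBundle (𝓡 m) X)) U

/-- The covector field `θ` is smooth on `X`. -/
def SmoothCovectorField (θ : Π x : X, TangentSpace (𝓡 m) x →L[ℝ] ℝ) : Prop :=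
  ContMDiff (𝓡 m) ((𝓡 m).prod 𝓘(ℝ, EuclideanSpace ℝ (Fin m) →L[ℝ] ℝ)) ∞
    (fun x => TotalSpace.mk' (EuclideanSpace ℝ (Fin m) →L[ℝ] ℝ) x (θ x))

/-- The `(0,2)`-tensor field `T` is smooth on `X`. -/
def SmoothTensorField
    (T : Π x : X, TangentSpace (𝓡 m) x →L[ℝ] TangentSpace (𝓡 m) x →L[ℝ] ℝ) : Prop :=
  ContMDiff (𝓡 m)
    ((𝓡 m).prod 𝓘(ℝ, EuclideanSpace ℝ (Fin m) →L[ℝ] EuclideanSpace ℝ (Fin m) →L[ℝ] ℝ)) ∞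
    (fun x => TotalSpace.mk'
      (EuclideanSpace ℝ (Fin m) →L[ℝ] EuclideanSpace ℝ (Fin m) →L[ℝ] ℝ) x (T x))

/-- The derivative `V(f)` of the function `f` along the vector field `V`, at `x`
(the Lie derivative of a scalar). -/
def lieDerivScalar (V : Π x : X, TangentSpace (𝓡 m) x) (f : X → ℝ) (x : X) : ℝ :=
  mfderiv (𝓡 m) 𝓘(ℝ, ℝ) f x (V x)

/-- The Lie derivative of a covector field,
`(£_V θ)(w) = V(θ(W)) - θ([V, W])`, evaluated on a vector `w` at `x`.  Here `W` is the local smooth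
extension of `w` that is constant in the preferred chart at `x`; as the right-hand side is tensorial
in `W`, any other smooth extension gives the same value. -/
def lieDerivCovector (V : Π x : X, TangentSpace (𝓡 m) x)
    (θ : Π x : X, TangentSpace (𝓡 m) x →L[ℝ] ℝ) (x : X) (w : TangentSpace (𝓡 m) x) : ℝ :=
  let W : Π y : X, TangentSpace (𝓡 m) y := FiberBundle.extend (EuclideanSpace ℝ (Fin m)) w
  lieDerivScalar V (fun y => θ y (W y)) x - θ x (VectorField.mlieBracket (𝓡 m) V W x)

/-- The Lie derivative of a `(0,2)`-tensor field,
`(£_V T)(w, z) = V(T(W, Z)) - T([V, W], Z) - T(W, [V, Z])`, evaluated on vectors `w`, `z` at `x`.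
Here `W`, `Z` are the local smooth extensions of `w`, `z` that are constant in the preferred chart
at `x`; as the right-hand side is tensorial in `W` and `Z`, any other smooth extensions give the
same value. -/
def lieDerivTensor (V : Π x : X, TangentSpace (𝓡 m) x)
    (T : Π x : X, TangentSpace (𝓡 m) x →L[ℝ] TangentSpace (𝓡 m) x →L[ℝ] ℝ) (x : X)
    (w z : TangentSpace (𝓡 m) x) : ℝ :=
  let W : Π y : X, TangentSpace (𝓡 m) y := FiberBundle.extend (EuclideanSpace ℝ (Fin m)) w
  let Z : Π y : X, TangentSpace (𝓡 m) y := FiberBundle.extend (EuclideanSpace ℝ (Fin m)) z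
  lieDerivScalar V (fun y => T y (W y) (Z y)) x
    - T x (VectorField.mlieBracket (𝓡 m) V W x) z
    - T x w (VectorField.mlieBracket (𝓡 m) V Z x)

end LieDerivative

/-- A smooth Lorentzian metric, of signature `(-,+,...,+)`, on a manifold `M` of dimension `m`. -/
structure LorentzianMetric (m : ℕ) (M : Type*) [TopologicalSpace M]
    [ChartedSpace (EuclideanSpace ℝ (Fin m)) M] [IsManifold (𝓡 m) ∞ M] where
  /-- the scalar product `g(v, w)` on each tangent space -/
  inner : Π x : M, TangentSpace (𝓡 m) x →L[ℝ] TangentSpace (𝓡 m) x →L[ℝ] ℝ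
  smooth : SmoothTensorField inner
  symm : ∀ x v w, inner x v w = inner x w v
  /-- there is a timelike vector, and `g` is positive definite on its orthogonal complement -/
  signature : ∀ x, ∃ v, inner x v v < 0 ∧ ∀ w, inner x v w = 0 → w ≠ 0 → 0 < inner x w w

/-- Null metric hypersurface data `{N, γ, ℓ, ℓ⁽²⁾}` on a manifold `N` of dimension `n`. -/
structure NullMetricHypersurfaceData (n : ℕ) (N : Type*) [TopologicalSpace N]
    [ChartedSpace (EuclideanSpace ℝ (Fin n)) N] [IsManifold (𝓡 n) ∞ N] where
  γ : Π p : N, TangentSpace (𝓡 n) p →L[ℝ] TangentSpace (𝓡 n) p →L[ℝ] ℝ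
  γ_smooth : SmoothTensorField γ
  γ_symm : ∀ p v w, γ p v w = γ p w v
  /-- `γ` has signature `(0,+,...,+)`: it is positive semidefinite with one-dimensional radical -/
  γ_nonneg : ∀ p v, 0 ≤ γ p v v
  γ_radical : ∀ p, Module.finrank ℝ (LinearMap.ker (γ p).toLinearMap) = 1
  ℓ : Π p : N, TangentSpace (𝓡 n) p →L[ℝ] ℝ
  ℓ_smooth : SmoothCovectorField ℓ
  /-- the scalar `ℓ⁽²⁾` -/
  ℓ2 : N → ℝ
  ℓ2_smooth : ContMDiff (𝓡 n) 𝓘(ℝ, ℝ) ∞ ℓ2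
  /-- the bilinear form
  `𝒜((W,a),(Z,b)) = γ(W,Z) + a ℓ(Z) + b ℓ(W) + a b ℓ⁽²⁾` on `T_pN × ℝ` is non-degenerate -/
  nondegenerate : ∀ (p : N) (W : TangentSpace (𝓡 n) p) (a : ℝ),
    (∀ (Z : TangentSpace (𝓡 n) p) (b : ℝ),
      γ p W Z + a * ℓ p Z + b * ℓ p W + a * b * ℓ2 p = 0) → W = 0 ∧ a = 0

/-- Null hypersurface data `{N, γ, ℓ, ℓ⁽²⁾, Y}`. -/
structure NullHypersurfaceData (n : ℕ) (N : Type*) [TopologicalSpace N]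
    [ChartedSpace (EuclideanSpace ℝ (Fin n)) N] [IsManifold (𝓡 n) ∞ N] extends
    NullMetricHypersurfaceData n N where
  Y : Π p : N, TangentSpace (𝓡 n) p →L[ℝ] TangentSpace (𝓡 n) p →L[ℝ] ℝ
  Y_smooth : SmoothTensorField Y
  Y_symm : ∀ p v w, Y p v w = Y p w v

section Horizons

variable {n : ℕ}
  {N : Type*} [TopologicalSpace N] [ChartedSpace (EuclideanSpace ℝ (Fin n)) N]
  [IsManifold (𝓡 n) ∞ N]
  {M : Type*} [TopologicalSpace M] [ChartedSpace (EuclideanSpace ℝ (Fin (n + 1))) M]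
  [IsManifold (𝓡 (n + 1)) ∞ M]

/-- The vector field `Z` on `M` is a smooth extension, to a neighbourhood of `φ p`, of the
vector field `ζ` along `φ`. -/
def ExtendsNear (φ : N → M) (ζ : Π p : N, TangentSpace (𝓡 (n + 1)) (φ p)) (p : N)
    (Z : Π x : M, TangentSpace (𝓡 (n + 1)) x) : Prop :=
  ∃ U : Set M, IsOpen U ∧ φ p ∈ U ∧ SmoothVectorFieldOn Z U ∧ ∀ q, φ q ∈ U → Z (φ q) = ζ q

/-- Abstract Killing horizon of order zero, with symmetry generator `ηbar`: a smooth vector field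
in the radical of `γ` whose zero set has empty interior and with `£_ηbar γ = 0`. -/
structure IsAbstractKillingHorizonZero (D : NullHypersurfaceData n N)
    (ηbar : Π p : N, TangentSpace (𝓡 n) p) : Prop where
  smooth : SmoothVectorFieldOn ηbar univ
  radical : ∀ p w, D.γ p (ηbar p) w = 0
  interior_zeros : interior {p : N | ηbar p = 0} = ∅
  lieDeriv_γ : ∀ p v w, lieDerivTensor ηbar D.γ p v w = 0

/-- The null hypersurface data `D` is embedded in `(M, g)` with embedding `φ` and rigging `ζ`, a
smooth vector field along `φ` which is everywhere transverse to `φ(N)`.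

The pull-back to `N` of `£_ζ g` does not depend on how `ζ` is extended off `φ(N)`, and `ζ` has smooth
extensions near every point because `φ` is an embedding; so it is computed with some extension. -/
structure IsEmbedded (D : NullHypersurfaceData n N) (g : LorentzianMetric (n + 1) M) (φ : N → M)
    (ζ : Π p : N, TangentSpace (𝓡 (n + 1)) (φ p)) : Prop where
  isSmoothEmbedding : Manifold.IsSmoothEmbedding (𝓡 n) (𝓡 (n + 1)) ∞ φ
  rigging_smooth : ContMDiff (𝓡 n) (𝓡 (n + 1)).tangent ∞
    (fun p => (⟨φ p, ζ p⟩ : TangentBundle (𝓡 (n + 1)) M))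
  rigging_transverse : ∀ p v, mfderiv (𝓡 n) (𝓡 (n + 1)) φ p v ≠ ζ p
  pullback_γ : ∀ p v w, g.inner (φ p) (mfderiv (𝓡 n) (𝓡 (n + 1)) φ p v)
    (mfderiv (𝓡 n) (𝓡 (n + 1)) φ p w) = D.γ p v w
  pullback_ℓ : ∀ p v, g.inner (φ p) (ζ p) (mfderiv (𝓡 n) (𝓡 (n + 1)) φ p v) = D.ℓ p v
  pullback_ℓ2 : ∀ p, g.inner (φ p) (ζ p) (ζ p) = D.ℓ2 p
  pullback_Y : ∀ p, ∃ Z : Π x : M, TangentSpace (𝓡 (n + 1)) x, ExtendsNear φ ζ p Z ∧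
    ∀ v w, (1 / 2 : ℝ) * lieDerivTensor Z g.inner (φ p) (mfderiv (𝓡 n) (𝓡 (n + 1)) φ p v)
      (mfderiv (𝓡 n) (𝓡 (n + 1)) φ p w) = D.Y p v w

/-- `φ(N)` is a Killing horizon of order zero: `D` is an abstract Killing horizon of order zero with
symmetry generator `ηbar`, it is embedded in `(M, g)` with embedding `φ` and rigging `ζ`, and `η` is a
smooth extension of `φ_⋆ ηbar` to the open neighbourhood `O` of `φ(N)` such that
`φ^⋆(g(£_ζ η, ζ)) = -(1/2) £_ηbar ℓ⁽²⁾` and `φ^⋆(g(£_ζ η, ·)) = -£_ηbar ℓ` on `N`.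

As `η` is tangent to `φ(N)`, the vector `£_ζ η = [ζ, η]` at a point of `φ(N)` does not depend on how
`ζ` is extended off `φ(N)`; so it is computed with some extension. -/
structure IsKillingHorizonZero (D : NullHypersurfaceData n N)
    (ηbar : Π p : N, TangentSpace (𝓡 n) p) (g : LorentzianMetric (n + 1) M) (φ : N → M)
    (ζ : Π p : N, TangentSpace (𝓡 (n + 1)) (φ p)) (O : Set M)
    (η : Π x : M, TangentSpace (𝓡 (n + 1)) x) : Prop where
  abstractHorizon : IsAbstractKillingHorizonZero D ηbar
  embedded : IsEmbedded D g φ ζ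
  isOpen : IsOpen O
  range_subset : range φ ⊆ O
  smooth : SmoothVectorFieldOn η O
  extends_generator : ∀ p, η (φ p) = mfderiv (𝓡 n) (𝓡 (n + 1)) φ p (ηbar p)
  lieDeriv_rigging : ∀ p, ∃ Z : Π x : M, TangentSpace (𝓡 (n + 1)) x, ExtendsNear φ ζ p Z ∧
    g.inner (φ p) (VectorField.mlieBracket (𝓡 (n + 1)) Z η (φ p)) (ζ p)
      = -(1 / 2 : ℝ) * lieDerivScalar ηbar D.ℓ2 p ∧
    ∀ v, g.inner (φ p) (VectorField.mlieBracket (𝓡 (n + 1)) Z η (φ p))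
      (mfderiv (𝓡 n) (𝓡 (n + 1)) φ p v) = -lieDerivCovector ηbar D.ℓ p v

end Horizons

/-- The deformation tensor `K = £_η g` of the vector field `η`. -/
def deformationTensor {m : ℕ} {M : Type*} [TopologicalSpace M]
    [ChartedSpace (EuclideanSpace ℝ (Fin m)) M] [IsManifold (𝓡 m) ∞ M]
    (g : LorentzianMetric m M) (η : Π x : M, TangentSpace (𝓡 m) x) (x : M)
    (v w : TangentSpace (𝓡 m) x) : ℝ :=
  lieDerivTensor η g.inner x v w

end HypersurfaceData

end

/-! At a point of the horizon the ambient tangent space is the image of `dφ` plus the line spanned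
by `ζ`, so the symmetric bilinear form `K = £_η g` vanishes once its three blocks do. Extend `ζ` to
a local field `Z`. Since `η` is `φ`-related to `ηbar`, the Leibniz rule gives, for `v` and `w`
tangent to `N`, `K(φ_⋆ v, φ_⋆ w) = (£_ηbar γ)(v, w)`, `K(Z, φ_⋆ v) = (£_ηbar ℓ)(v) + g([Z, η], φ_⋆
v)`, `K(Z, Z) = ηbar(ℓ⁽²⁾) + 2 g([Z, η], Z)`. The first is zero for an abstract horizon of order
zero. The two conditions on `£_ζ η = [Z, η]` say exactly that the other two are zero. The identities
are proved by calculus in normed spaces: `lieTensorModel_pullback`,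
`lieTensorModel_sub_lieCovectorModel` and `lieTensorModel_self`. The transfer to manifolds uses the
preferred charts at `p` and `φ p`: `lieDerivTensor_eq` and `lieDerivCovector_eq` identify the
invariant Lie derivatives with the coordinate formulas, and the pull-back lemmas restate the
embedding conditions for the chart representatives. `exists_eq_add_smul_of_transverse` supplies the
splitting. -/

noncomputable section

namespace HypersurfaceData

/-! ### Lie derivatives and related vector fields in normed spaces -/

section Model

variable {E F : Type*} [NormedAddCommGroup E] [NormedSpace ℝ E]
  [NormedAddCommGroup F] [NormedSpace ℝ F]

/-- The Lie derivative of a covector field on a normed space. -/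
def lieCovectorModel (V : E → E) (θ : E → E →L[ℝ] ℝ) (x v : E) : ℝ :=
  fderiv ℝ θ x (V x) v + θ x (fderiv ℝ V x v)

/-- The Lie derivative of a `(0,2)`-tensor field on a normed space. -/
def lieTensorModel (V : E → E) (T : E → E →L[ℝ] E →L[ℝ] ℝ) (x v w : E) : ℝ :=
  fderiv ℝ T x (V x) v w + T x (fderiv ℝ V x v) w + T x v (fderiv ℝ V x w)

theorem hasFDerivAt_clm_comp_apply {G : Type*} [NormedAddCommGroup G] [NormedSpace ℝ G]
    {f : E → F} {a : E → F} {a' : E →L[ℝ] F} {x : E} {T : F → F →L[ℝ] G}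
    (hT : DifferentiableAt ℝ T (f x)) (hf : DifferentiableAt ℝ f x) (ha : HasFDerivAt a a' x) :
    HasFDerivAt (fun u => T (f u) (a u))
      ((T (f x)).comp a' + ((fderiv ℝ T (f x)).comp (fderiv ℝ f x)).flip (a x)) x :=
  (hT.hasFDerivAt.comp x hf.hasFDerivAt).clm_apply ha

/-- The derivative of `u ↦ T(f u)(a u, b u)`. -/
theorem fderiv_tensor_comp_apply {f : E → F} {a b : E → F} {x : E} {T : F → F →L[ℝ] F →L[ℝ] ℝ}
    (hT : DifferentiableAt ℝ T (f x)) (hf : DifferentiableAt ℝ f x)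
    (ha : DifferentiableAt ℝ a x) (hb : DifferentiableAt ℝ b x) (e : E) :
    fderiv ℝ (fun u => T (f u) (a u) (b u)) x e =
      fderiv ℝ T (f x) (fderiv ℝ f x e) (a x) (b x) + T (f x) (fderiv ℝ a x e) (b x)
        + T (f x) (a x) (fderiv ℝ b x e) := by
  have h1 := hasFDerivAt_clm_comp_apply hT hf ha.hasFDerivAt
  have h2 := h1.clm_apply hb.hasFDerivAt
  rw [h2.fderiv]
  simp only [add_apply, ContinuousLinearMap.comp_apply, ContinuousLinearMap.flip_apply]
  ring

/-- The derivative of `u ↦ θ(u)(v)`. -/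
theorem fderiv_clm_apply_const {G : Type*} [NormedAddCommGroup G] [NormedSpace ℝ G]
    {θ : E → E →L[ℝ] G} {x : E} (hθ : DifferentiableAt ℝ θ x) (v e : E) :
    fderiv ℝ (fun u => θ u v) x e = fderiv ℝ θ x e v := by
  rw [(hθ.hasFDerivAt.clm_apply (hasFDerivAt_const v x)).fderiv]
  simp

/-- Related vector fields: the derivative of the relation `η ∘ f = Df(ξ)`. -/
theorem fderiv_apply_of_related {f : E → F} {ξ : E → E} {η : F → F} {x : E}
    (hf : ContDiffAt ℝ 2 f x) (hξ : DifferentiableAt ℝ ξ x) (hη : DifferentiableAt ℝ η (f x))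
    (h : ∀ᶠ u in 𝓝 x, η (f u) = fderiv ℝ f u (ξ u)) (v : E) :
    fderiv ℝ η (f x) (fderiv ℝ f x v) =
      fderiv ℝ (fderiv ℝ f) x v (ξ x) + fderiv ℝ f x (fderiv ℝ ξ x v) := by
  have hf1 : DifferentiableAt ℝ f x := hf.differentiableAt (by norm_num)
  have hf2 : DifferentiableAt ℝ (fderiv ℝ f) x :=
    (hf.fderiv_right (m := 1) (by norm_num)).differentiableAt (by norm_num)
  have h1 := (hη.hasFDerivAt.comp x hf1.hasFDerivAt)
  have h2 := (hf2.hasFDerivAt.clm_apply hξ.hasFDerivAt)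
  have h3 := h1.unique (h2.congr_of_eventuallyEq h)
  have := congrArg (fun A : E →L[ℝ] F => A v) h3
  simpa [add_comm] using this

theorem fderiv_fderiv_comm {f : E → F} {x : E} (hf : ContDiffAt ℝ 2 f x) (v w : E) :
    fderiv ℝ (fderiv ℝ f) x v w = fderiv ℝ (fderiv ℝ f) x w v :=
  hf.isSymmSndFDerivAt (by simp) v w

/-- The Lie derivative of a `(0,2)`-tensor field commutes with pull-back. -/
theorem lieTensorModel_pullback {f : E → F} {ξ : E → E} {η : F → F} {x : E}
    {T : F → F →L[ℝ] F →L[ℝ] ℝ} {S : E → E →L[ℝ] E →L[ℝ] ℝ}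
    (hf : ContDiffAt ℝ 2 f x) (hξ : DifferentiableAt ℝ ξ x) (hη : DifferentiableAt ℝ η (f x))
    (hT : DifferentiableAt ℝ T (f x)) (hS : DifferentiableAt ℝ S x)
    (h : ∀ᶠ u in 𝓝 x, η (f u) = fderiv ℝ f u (ξ u))
    (hST : ∀ᶠ u in 𝓝 x, ∀ v w, S u v w = T (f u) (fderiv ℝ f u v) (fderiv ℝ f u w)) (v w : E) :
    lieTensorModel η T (f x) (fderiv ℝ f x v) (fderiv ℝ f x w) = lieTensorModel ξ S x v w := by
  have hf1 : DifferentiableAt ℝ f x := hf.differentiableAt (by norm_num)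
  have hf2 : DifferentiableAt ℝ (fderiv ℝ f) x :=
    (hf.fderiv_right (m := 1) (by norm_num)).differentiableAt (by norm_num)
  have hd : ∀ c : E, DifferentiableAt ℝ (fun u => fderiv ℝ f u c) x := fun c =>
    hf2.clm_apply (differentiableAt_const c)
  have h4 : fderiv ℝ S x (ξ x) v w = _ :=
    calc fderiv ℝ S x (ξ x) v w
      _ = fderiv ℝ (fun u => S u v w) x (ξ x) := by
        rw [fderiv_clm_apply_const (θ := fun u => S u v)
          (hS.clm_apply (differentiableAt_const v)) w, fderiv_clm_apply_const hS v]
      _ = fderiv ℝ (fun u => T (f u) (fderiv ℝ f u v) (fderiv ℝ f u w)) x (ξ x) := by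
        rw [Filter.EventuallyEq.fderiv_eq (hST.mono fun u hu => hu v w)]
      _ = _ := fderiv_tensor_comp_apply hT hf1 (hd v) (hd w) (ξ x)
  simp only [fderiv_clm_apply_const hf2] at h4
  have hx := hST.self_of_nhds
  -- Both sides contain second derivatives of `f`: on the left from differentiating `η ∘ f = Df(ξ)`,
  -- on the right from differentiating `Df(·) v` and `Df(·) w` along `ξ`. Symmetry of `D²f` makes
  -- them agree.
  simp only [lieTensorModel, fderiv_apply_of_related hf hξ hη h, h.self_of_nhds, hx, map_add,
    add_apply, fderiv_fderiv_comm hf _ (ξ x)]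
  rw [h4]
  ring

/-- The Lie derivatives of `g(Z, ·)` and of `g` along related fields differ by `g([Z, η], ·)`. -/
theorem lieTensorModel_sub_lieCovectorModel {f : E → F} {ξ : E → E} {η Z : F → F} {x : E}
    {T : F → F →L[ℝ] F →L[ℝ] ℝ} {θ : E → E →L[ℝ] ℝ}
    (hf : ContDiffAt ℝ 2 f x) (hξ : DifferentiableAt ℝ ξ x) (hη : DifferentiableAt ℝ η (f x))
    (hZ : DifferentiableAt ℝ Z (f x))
    (hT : DifferentiableAt ℝ T (f x)) (hθ : DifferentiableAt ℝ θ x)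
    (h : ∀ᶠ u in 𝓝 x, η (f u) = fderiv ℝ f u (ξ u))
    (hθT : ∀ᶠ u in 𝓝 x, ∀ v, θ u v = T (f u) (Z (f u)) (fderiv ℝ f u v)) (v : E) :
    lieTensorModel η T (f x) (Z (f x)) (fderiv ℝ f x v) = lieCovectorModel ξ θ x v
      + T (f x) (VectorField.lieBracket ℝ Z η (f x)) (fderiv ℝ f x v) := by
  have hf1 : DifferentiableAt ℝ f x := hf.differentiableAt (by norm_num)
  have hf2 : DifferentiableAt ℝ (fderiv ℝ f) x :=
    (hf.fderiv_right (m := 1) (by norm_num)).differentiableAt (by norm_num)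
  have hd : ∀ c : E, DifferentiableAt ℝ (fun u => fderiv ℝ f u c) x := fun c =>
    hf2.clm_apply (differentiableAt_const c)
  have h4 : fderiv ℝ θ x (ξ x) v = _ :=
    calc fderiv ℝ θ x (ξ x) v
      _ = fderiv ℝ (fun u => θ u v) x (ξ x) := by rw [fderiv_clm_apply_const hθ v]
      _ = fderiv ℝ (fun u => T (f u) (Z (f u)) (fderiv ℝ f u v)) x (ξ x) := by
        rw [Filter.EventuallyEq.fderiv_eq (hθT.mono fun u hu => hu v)]
      _ = _ := fderiv_tensor_comp_apply hT hf1 (hZ.comp x hf1) (hd v) (ξ x)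
  rw [fderiv_clm_apply_const hf2, fderiv_comp x hZ hf1] at h4
  have hx := hθT.self_of_nhds
  -- The transverse derivative `Dη(Z)` is not determined by `f` and `ξ`; it survives only inside
  -- `[Z, η]`. The field `Z` is differentiated only along `η`, which is tangent to the image of `f`.
  simp only [lieTensorModel, lieCovectorModel, VectorField.lieBracket,
    fderiv_apply_of_related hf hξ hη h, h.self_of_nhds, hx, map_add, map_sub,
    sub_apply, fderiv_fderiv_comm hf _ (ξ x)]
  simp only [Function.comp_apply, ContinuousLinearMap.comp_apply] at h4
  rw [h4]
  ring

/-- The derivative of `g(Z, Z)` along related fields. -/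
theorem lieTensorModel_self {f : E → F} {ξ : E → E} {η Z : F → F} {x : E}
    {T : F → F →L[ℝ] F →L[ℝ] ℝ} {r : E → ℝ}
    (hf : DifferentiableAt ℝ f x) (hZ : DifferentiableAt ℝ Z (f x))
    (hT : DifferentiableAt ℝ T (f x))
    (hsymm : ∀ v w, T (f x) v w = T (f x) w v)
    (h : η (f x) = fderiv ℝ f x (ξ x))
    (hrT : ∀ᶠ u in 𝓝 x, r u = T (f u) (Z (f u)) (Z (f u))) :
    lieTensorModel η T (f x) (Z (f x)) (Z (f x)) = fderiv ℝ r x (ξ x)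
      + 2 * T (f x) (VectorField.lieBracket ℝ Z η (f x)) (Z (f x)) := by
  have h4 : fderiv ℝ r x (ξ x) = _ :=
    calc fderiv ℝ r x (ξ x)
      _ = fderiv ℝ (fun u => T (f u) (Z (f u)) (Z (f u))) x (ξ x) := by
        rw [Filter.EventuallyEq.fderiv_eq hrT]
      _ = _ := fderiv_tensor_comp_apply hT hf (hZ.comp x hf) (hZ.comp x hf) (ξ x)
  rw [fderiv_comp x hZ hf] at h4
  simp only [lieTensorModel, VectorField.lieBracket, h, map_sub, sub_apply]
  simp only [Function.comp_apply, ContinuousLinearMap.comp_apply] at h4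
  rw [h4, hsymm (Z (f x)), hsymm (Z (f x))]
  ring

end Model

/-! ### Tensor fields in the preferred chart and their differentiability -/

section Charts

variable {m : ℕ} {X : Type*} [TopologicalSpace X] [ChartedSpace (EuclideanSpace ℝ (Fin m)) X]
  [IsManifold (𝓡 m) ∞ X]

/-- The tangent vector at `x` with components `a` in the preferred chart at `x₀`. -/
def frame (x₀ x : X) : EuclideanSpace ℝ (Fin m) →L[ℝ] TangentSpace (𝓡 m) x :=
  (trivializationAt (EuclideanSpace ℝ (Fin m)) (TangentSpace (𝓡 m)) x₀).symmL ℝ x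

/-- The components in the preferred chart at `x₀` of a tangent vector at `x`. -/
def coframe (x₀ x : X) : TangentSpace (𝓡 m) x →L[ℝ] EuclideanSpace ℝ (Fin m) :=
  (trivializationAt (EuclideanSpace ℝ (Fin m)) (TangentSpace (𝓡 m)) x₀).continuousLinearMapAt ℝ x

omit [IsManifold (𝓡 m) ∞ X] in
theorem eventually_chart_symm {x₀ : X} {P : X → Prop} (h : ∀ᶠ x in 𝓝 x₀, P x) :
    ∀ᶠ e in 𝓝 (extChartAt (𝓡 m) x₀ x₀), P ((extChartAt (𝓡 m) x₀).symm e) := by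
  have h1 := continuousAt_extChartAt_symm (I := 𝓡 m) x₀
  rw [ContinuousAt, extChartAt_to_inv] at h1
  exact h1.eventually h

omit [IsManifold (𝓡 m) ∞ X] in
theorem eventually_mem_source (x₀ : X) :
    ∀ᶠ x in 𝓝 x₀, x ∈ (chartAt (EuclideanSpace ℝ (Fin m)) x₀).source :=
  chart_source_mem_nhds _ x₀

theorem frame_apply {x₀ x : X} (hx : x ∈ (chartAt (EuclideanSpace ℝ (Fin m)) x₀).source)
    (a : EuclideanSpace ℝ (Fin m)) : frame x₀ x a =
      (trivializationAt (EuclideanSpace ℝ (Fin m)) (TangentSpace (𝓡 m)) x₀).symm x a :=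
  (trivializationAt (EuclideanSpace ℝ (Fin m)) (TangentSpace (𝓡 m)) x₀).symmL_apply hx a

theorem frame_coframe {x₀ x : X} (hx : x ∈ (chartAt (EuclideanSpace ℝ (Fin m)) x₀).source)
    (v : TangentSpace (𝓡 m) x) : frame x₀ x (coframe x₀ x v) = v :=
  (trivializationAt (EuclideanSpace ℝ (Fin m)) (TangentSpace (𝓡 m)) x₀).symmL_continuousLinearMapAt
    hx v

theorem coframe_frame {x₀ x : X} (hx : x ∈ (chartAt (EuclideanSpace ℝ (Fin m)) x₀).source)
    (a : EuclideanSpace ℝ (Fin m)) : coframe x₀ x (frame x₀ x a) = a :=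
  (trivializationAt (EuclideanSpace ℝ (Fin m)) (TangentSpace (𝓡 m)) x₀).continuousLinearMapAt_symmL
    hx a

theorem frame_eq {x₀ x : X} (hx : x ∈ (chartAt (EuclideanSpace ℝ (Fin m)) x₀).source) :
    frame x₀ x = mfderivWithin 𝓘(ℝ, EuclideanSpace ℝ (Fin m)) (𝓡 m) (extChartAt (𝓡 m) x₀).symm
      (range (𝓡 m)) (extChartAt (𝓡 m) x₀ x) :=
  TangentBundle.symmL_trivializationAt hx

theorem coframe_eq {x₀ x : X} (hx : x ∈ (chartAt (EuclideanSpace ℝ (Fin m)) x₀).source) :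
    coframe x₀ x = mfderiv (𝓡 m) 𝓘(ℝ, EuclideanSpace ℝ (Fin m)) (extChartAt (𝓡 m) x₀) x :=
  TangentBundle.continuousLinearMapAt_trivializationAt hx

/-- The tangent space at `x₀` is by construction the model space read in the preferred chart at
`x₀`, so that chart has identity differential there. At other points of the chart domain `frame` and
`coframe` are genuine coordinate changes. -/
theorem coframe_self (x₀ : X) (v : TangentSpace (𝓡 m) x₀) : coframe x₀ x₀ v = v := by
  rw [coframe_eq (mem_chart_source _ x₀), mfderiv_extChartAt_self]
  rfl

theorem frame_self (x₀ : X) (a : EuclideanSpace ℝ (Fin m)) : frame x₀ x₀ a = a := by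
  conv_rhs => rw [← coframe_frame (mem_chart_source _ x₀) a]
  exact (coframe_self _ _).symm

/-- The vector field `V` in the preferred chart at `x₀`. -/
def vectorRep (V : Π x : X, TangentSpace (𝓡 m) x) (x₀ : X) (e : EuclideanSpace ℝ (Fin m)) :
    EuclideanSpace ℝ (Fin m) :=
  coframe x₀ ((extChartAt (𝓡 m) x₀).symm e) (V ((extChartAt (𝓡 m) x₀).symm e))

/-- The covector field `θ` in the preferred chart at `x₀`. -/
def covectorRep (θ : Π x : X, TangentSpace (𝓡 m) x →L[ℝ] ℝ) (x₀ : X)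
    (e : EuclideanSpace ℝ (Fin m)) : EuclideanSpace ℝ (Fin m) →L[ℝ] ℝ :=
  ContinuousLinearMap.comp (θ ((extChartAt (𝓡 m) x₀).symm e))
    (frame x₀ ((extChartAt (𝓡 m) x₀).symm e))

/-- The `(0,2)`-tensor field `T` in the preferred chart at `x₀`. -/
def tensorRep (T : Π x : X, TangentSpace (𝓡 m) x →L[ℝ] TangentSpace (𝓡 m) x →L[ℝ] ℝ) (x₀ : X)
    (e : EuclideanSpace ℝ (Fin m)) :
    EuclideanSpace ℝ (Fin m) →L[ℝ] EuclideanSpace ℝ (Fin m) →L[ℝ] ℝ :=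
  LinearMap.toContinuousLinearMap
    { toFun := fun a => (T ((extChartAt (𝓡 m) x₀).symm e)
        (frame x₀ ((extChartAt (𝓡 m) x₀).symm e) a)).comp (frame x₀ ((extChartAt (𝓡 m) x₀).symm e))
      map_add' := fun a b => by rw [map_add, map_add]; rfl
      map_smul' := fun c a => by rw [map_smul, map_smul]; rfl }

@[simp] theorem covectorRep_apply (θ : Π x : X, TangentSpace (𝓡 m) x →L[ℝ] ℝ) (x₀ : X)
    (e a : EuclideanSpace ℝ (Fin m)) :
    covectorRep θ x₀ e a = θ ((extChartAt (𝓡 m) x₀).symm e)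
      (frame x₀ ((extChartAt (𝓡 m) x₀).symm e) a) := rfl

@[simp] theorem tensorRep_apply
    (T : Π x : X, TangentSpace (𝓡 m) x →L[ℝ] TangentSpace (𝓡 m) x →L[ℝ] ℝ) (x₀ : X)
    (e a b : EuclideanSpace ℝ (Fin m)) :
    tensorRep T x₀ e a b = T ((extChartAt (𝓡 m) x₀).symm e)
      (frame x₀ ((extChartAt (𝓡 m) x₀).symm e) a)
      (frame x₀ ((extChartAt (𝓡 m) x₀).symm e) b) := rfl

omit [IsManifold (𝓡 m) ∞ X] in
theorem differentiableAt_comp_chart_symm {G : Type*} [NormedAddCommGroup G] [NormedSpace ℝ G]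
    {f : X → G} {x₀ : X} (hf : ContMDiffAt (𝓡 m) 𝓘(ℝ, G) ∞ f x₀) :
    DifferentiableAt ℝ (fun e => f ((extChartAt (𝓡 m) x₀).symm e)) (extChartAt (𝓡 m) x₀ x₀) := by
  have := (contMDiffAt_iff.1 hf).2
  simp only [mfld_simps, contDiffWithinAt_univ] at this
  exact this.differentiableAt (by simp)

theorem mfderiv_frame {f : X → ℝ} {x₀ : X} (hf : MDifferentiableAt (𝓡 m) 𝓘(ℝ, ℝ) f x₀)
    (a : EuclideanSpace ℝ (Fin m)) :
    mfderiv (𝓡 m) 𝓘(ℝ, ℝ) f x₀ (frame x₀ x₀ a) =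
      fderiv ℝ (fun e => f ((extChartAt (𝓡 m) x₀).symm e)) (extChartAt (𝓡 m) x₀ x₀) a := by
  have h : HasMFDerivAt (𝓡 m) 𝓘(ℝ, ℝ) f x₀
      (fderiv ℝ (fun e => f ((extChartAt (𝓡 m) x₀).symm e)) (extChartAt (𝓡 m) x₀ x₀) :
        EuclideanSpace ℝ (Fin m) →L[ℝ] ℝ) := by
    refine ⟨hf.continuousAt, ?_⟩
    have := hf.differentiableWithinAt_writtenInExtChartAt
    simp only [mfld_simps, differentiableWithinAt_univ] at this ⊢
    exact this.hasFDerivAt.hasFDerivWithinAt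
  rw [h.mfderiv]
  exact congrArg (fderiv ℝ (fun e => f ((extChartAt (𝓡 m) x₀).symm e)) (extChartAt (𝓡 m) x₀ x₀))
    (frame_self x₀ a)

theorem frame_vectorRep_self (V : Π x : X, TangentSpace (𝓡 m) x) (x₀ : X) :
    frame x₀ x₀ (vectorRep V x₀ (extChartAt (𝓡 m) x₀ x₀)) = V x₀ := by
  rw [vectorRep, extChartAt_to_inv, frame_coframe (mem_chart_source _ x₀)]

theorem covectorRep_self (θ : Π x : X, TangentSpace (𝓡 m) x →L[ℝ] ℝ) (x₀ : X)
    (a : EuclideanSpace ℝ (Fin m)) :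
    covectorRep θ x₀ (extChartAt (𝓡 m) x₀ x₀) a = θ x₀ (frame x₀ x₀ a) := by
  rw [covectorRep_apply, extChartAt_to_inv]

theorem tensorRep_self
    (T : Π x : X, TangentSpace (𝓡 m) x →L[ℝ] TangentSpace (𝓡 m) x →L[ℝ] ℝ) (x₀ : X)
    (a b : EuclideanSpace ℝ (Fin m)) :
    tensorRep T x₀ (extChartAt (𝓡 m) x₀ x₀) a b = T x₀ (frame x₀ x₀ a) (frame x₀ x₀ b) := by
  rw [tensorRep_apply, extChartAt_to_inv]

/-- Smoothness of a section means smoothness of its second component in the trivialization, which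
agrees with `vectorRep` only over the chart domain; an eventual equality near the base point
suffices. -/
theorem vectorRep_differentiableAt {V : Π x : X, TangentSpace (𝓡 m) x} {U : Set X}
    (hV : SmoothVectorFieldOn V U) {x₀ : X} (hU : U ∈ 𝓝 x₀) :
    DifferentiableAt ℝ (vectorRep V x₀) (extChartAt (𝓡 m) x₀ x₀) := by
  have h1 := (hV.contMDiffAt hU)
  rw [contMDiffAt_section] at h1
  refine (differentiableAt_comp_chart_symm h1).congr_of_eventuallyEq ?_
  filter_upwards [eventually_chart_symm (eventually_mem_source (m := m) x₀)] with e hx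
  exact congrFun ((trivializationAt (EuclideanSpace ℝ (Fin m)) (TangentSpace (𝓡 m)) x₀
    ).coe_linearMapAt_of_mem (R := ℝ) hx) (V _)

theorem covectorRep_differentiableAt {θ : Π x : X, TangentSpace (𝓡 m) x →L[ℝ] ℝ}
    (hθ : SmoothCovectorField θ) (x₀ : X) :
    DifferentiableAt ℝ (covectorRep θ x₀) (extChartAt (𝓡 m) x₀ x₀) := by
  have h1 := hθ x₀
  rw [contMDiffAt_hom_bundle] at h1
  refine (differentiableAt_comp_chart_symm h1.2).congr_of_eventuallyEq ?_
  filter_upwards [eventually_chart_symm (eventually_mem_source (m := m) x₀)] with e he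
  ext1 a
  simp [ContinuousLinearMap.inCoordinates, covectorRep_apply, frame]
  rfl

theorem tensorRep_differentiableAt
    {T : Π x : X, TangentSpace (𝓡 m) x →L[ℝ] TangentSpace (𝓡 m) x →L[ℝ] ℝ}
    (hT : SmoothTensorField T) (x₀ : X) :
    DifferentiableAt ℝ (tensorRep T x₀) (extChartAt (𝓡 m) x₀ x₀) := by
  have h1 := hT x₀
  rw [contMDiffAt_hom_bundle] at h1
  refine (differentiableAt_comp_chart_symm h1.2).congr_of_eventuallyEq ?_
  filter_upwards [eventually_chart_symm (eventually_mem_source (m := m) x₀)] with e he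
  ext1 a
  ext1 b
  refine Eq.trans ?_ (inCoordinates_apply_eq₂ (𝕜 := ℝ) he he (mem_univ _)).symm
  rw [tensorRep_apply, frame_apply he, frame_apply he]
  simp

end Charts

/-! ### Brackets and Lie derivatives in coordinates -/

section Charts

variable {m : ℕ} {X : Type*} [TopologicalSpace X] [ChartedSpace (EuclideanSpace ℝ (Fin m)) X]
  [IsManifold (𝓡 m) ∞ X]

theorem mpullbackWithin_eventuallyEq_vectorRep (V : Π x : X, TangentSpace (𝓡 m) x) (x₀ : X) :
    VectorField.mpullbackWithin 𝓘(ℝ, EuclideanSpace ℝ (Fin m)) (𝓡 m) (extChartAt (𝓡 m) x₀).symm V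
      (range (𝓡 m)) =ᶠ[𝓝 (extChartAt (𝓡 m) x₀ x₀)] vectorRep V x₀ := by
  filter_upwards [eventually_chart_symm (eventually_mem_source (m := m) x₀),
    extChartAt_target_mem_nhds (I := 𝓡 m) x₀] with e he he'
  have h1 := frame_eq he
  rw [(extChartAt (𝓡 m) x₀).right_inv he'] at h1
  rw [VectorField.mpullbackWithin_apply, ← h1]
  exact DFunLike.congr_fun (ContinuousLinearMap.inverse_eq
    (ContinuousLinearMap.ext fun v => frame_coframe he v)
    (ContinuousLinearMap.ext fun a => coframe_frame he a)) _

theorem lieBracketWithin_eq_of_eventuallyEq {E : Type*} [NormedAddCommGroup E] [NormedSpace ℝ E]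
    {V V' W W' : E → E} {x : E} {s : Set E} (hV : V =ᶠ[𝓝 x] V') (hW : W =ᶠ[𝓝 x] W')
    (hs : s = univ) :
    VectorField.lieBracketWithin ℝ V W s x = VectorField.lieBracket ℝ V' W' x := by
  rw [hs, VectorField.lieBracketWithin_univ, hV.lieBracket_vectorField_eq hW]

/-- The manifold bracket is defined by pulling both fields back along the inverse chart, which near
the base point yields their coordinate representatives. The inverse differential of the chart, which
carries the result back, is `frame`. -/
theorem mlieBracket_eq (V W : Π x : X, TangentSpace (𝓡 m) x) (x₀ : X) :
    VectorField.mlieBracket (𝓡 m) V W x₀ = frame x₀ x₀ (VectorField.lieBracket ℝ (vectorRep V x₀)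
      (vectorRep W x₀) (extChartAt (𝓡 m) x₀ x₀)) := by
  have h1 : (coframe x₀ x₀).inverse = frame x₀ x₀ := ContinuousLinearMap.inverse_eq
    (ContinuousLinearMap.ext fun a => coframe_frame (m := m) (mem_chart_source _ x₀) a)
    (ContinuousLinearMap.ext fun v => frame_coframe (m := m) (mem_chart_source _ x₀) v)
  rw [← h1, coframe_eq (mem_chart_source _ x₀), VectorField.mlieBracket,
    VectorField.mlieBracketWithin_apply]
  exact congrArg _ (lieBracketWithin_eq_of_eventuallyEq
    (mpullbackWithin_eventuallyEq_vectorRep V x₀) (mpullbackWithin_eventuallyEq_vectorRep W x₀)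
    (by simp))

theorem extend_frame {x₀ x : X} (hx : x ∈ (chartAt (EuclideanSpace ℝ (Fin m)) x₀).source)
    (a : EuclideanSpace ℝ (Fin m)) :
    FiberBundle.extend (EuclideanSpace ℝ (Fin m)) (frame x₀ x₀ a) x = frame x₀ x a := by
  have h : (trivializationAt (EuclideanSpace ℝ (Fin m)) (TangentSpace (𝓡 m)) x₀
      ⟨x₀, frame x₀ x₀ a⟩).2 = a := by
    conv_rhs => rw [← coframe_frame (mem_chart_source _ x₀) a]
    exact (congrFun ((trivializationAt (EuclideanSpace ℝ (Fin m)) (TangentSpace (𝓡 m)) x₀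
      ).coe_linearMapAt_of_mem (R := ℝ) (FiberBundle.mem_baseSet_trivializationAt' x₀)) _).symm
  rw [FiberBundle.extend, h, frame_apply hx]

theorem vectorRep_extend_eventuallyEq (x₀ : X) (a : EuclideanSpace ℝ (Fin m)) :
    vectorRep (FiberBundle.extend (EuclideanSpace ℝ (Fin m)) (frame x₀ x₀ a)) x₀
      =ᶠ[𝓝 (extChartAt (𝓡 m) x₀ x₀)] fun _ => a := by
  filter_upwards [eventually_chart_symm (eventually_mem_source (m := m) x₀)] with e he
  rw [vectorRep, extend_frame he, coframe_frame he]

/-- The extension has constant components `a`, so only the term `-DV(a)` of the bracket survives. -/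
theorem mlieBracket_extend (V : Π x : X, TangentSpace (𝓡 m) x) (x₀ : X)
    (a : EuclideanSpace ℝ (Fin m)) :
    VectorField.mlieBracket (𝓡 m) V
        (FiberBundle.extend (EuclideanSpace ℝ (Fin m)) (frame x₀ x₀ a)) x₀ =
      -frame x₀ x₀ (fderiv ℝ (vectorRep V x₀) (extChartAt (𝓡 m) x₀ x₀) a) := by
  rw [mlieBracket_eq, VectorField.lieBracket, (vectorRep_extend_eventuallyEq x₀ a).fderiv_eq,
    (vectorRep_extend_eventuallyEq x₀ a).self_of_nhds, fderiv_fun_const, Pi.zero_apply, zero_apply,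
    zero_sub, map_neg]

theorem mdifferentiableAt_covector_extend {θ : Π x : X, TangentSpace (𝓡 m) x →L[ℝ] ℝ}
    (hθ : SmoothCovectorField θ) {x₀ : X} (w : TangentSpace (𝓡 m) x₀) :
    MDifferentiableAt (𝓡 m) 𝓘(ℝ, ℝ)
      (fun y => θ y (FiberBundle.extend (EuclideanSpace ℝ (Fin m)) w y)) x₀ := by
  have h := MDifferentiableAt.clm_bundle_apply (F₂ := ℝ) (E₂ := Bundle.Trivial X ℝ)
    ((hθ x₀).mdifferentiableAt (by simp))
    (FiberBundle.mdifferentiableAt_extend (I := 𝓡 m) (EuclideanSpace ℝ (Fin m)) w)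
  exact ((mdifferentiableAt_totalSpace _ _).1 h).2

theorem mdifferentiableAt_tensor_extend
    {T : Π x : X, TangentSpace (𝓡 m) x →L[ℝ] TangentSpace (𝓡 m) x →L[ℝ] ℝ}
    (hT : SmoothTensorField T) {x₀ : X} (w z : TangentSpace (𝓡 m) x₀) :
    MDifferentiableAt (𝓡 m) 𝓘(ℝ, ℝ)
      (fun y => T y (FiberBundle.extend (EuclideanSpace ℝ (Fin m)) w y)
        (FiberBundle.extend (EuclideanSpace ℝ (Fin m)) z y)) x₀ := by
  have h := MDifferentiableAt.clm_bundle_apply₂ (F₃ := ℝ) (E₃ := Bundle.Trivial X ℝ)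
    ((hT x₀).mdifferentiableAt (by simp))
    (FiberBundle.mdifferentiableAt_extend (I := 𝓡 m) (EuclideanSpace ℝ (Fin m)) w)
    (FiberBundle.mdifferentiableAt_extend (I := 𝓡 m) (EuclideanSpace ℝ (Fin m)) z)
  exact ((mdifferentiableAt_totalSpace _ _).1 h).2

theorem lieDerivCovector_eq (V : Π x : X, TangentSpace (𝓡 m) x)
    {θ : Π x : X, TangentSpace (𝓡 m) x →L[ℝ] ℝ} (hθ : SmoothCovectorField θ) (x₀ : X)
    (a : EuclideanSpace ℝ (Fin m)) :
    lieDerivCovector V θ x₀ (frame x₀ x₀ a) =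
      lieCovectorModel (vectorRep V x₀) (covectorRep θ x₀) (extChartAt (𝓡 m) x₀ x₀) a := by
  have h : (fun e => θ ((extChartAt (𝓡 m) x₀).symm e)
      (FiberBundle.extend (EuclideanSpace ℝ (Fin m)) (frame x₀ x₀ a)
        ((extChartAt (𝓡 m) x₀).symm e)))
      =ᶠ[𝓝 (extChartAt (𝓡 m) x₀ x₀)] fun e => covectorRep θ x₀ e a := by
    filter_upwards [eventually_chart_symm (eventually_mem_source (m := m) x₀)] with e he
    rw [extend_frame he, covectorRep_apply]
  rw [lieDerivCovector, lieCovectorModel, lieDerivScalar, ← frame_vectorRep_self V x₀,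
    mfderiv_frame (mdifferentiableAt_covector_extend hθ _), h.fderiv_eq,
    fderiv_clm_apply_const (covectorRep_differentiableAt hθ x₀), mlieBracket_extend,
    covectorRep_self, map_neg, sub_neg_eq_add]

/-- With extensions of constant components, the scalar derivative only differentiates the
coefficients of `T`, and the two brackets contribute the `DV` terms, their minus signs cancelling
those of the definition. -/
theorem lieDerivTensor_eq (V : Π x : X, TangentSpace (𝓡 m) x)
    {T : Π x : X, TangentSpace (𝓡 m) x →L[ℝ] TangentSpace (𝓡 m) x →L[ℝ] ℝ}
    (hT : SmoothTensorField T) (x₀ : X) (a b : EuclideanSpace ℝ (Fin m)) :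
    lieDerivTensor V T x₀ (frame x₀ x₀ a) (frame x₀ x₀ b) =
      lieTensorModel (vectorRep V x₀) (tensorRep T x₀) (extChartAt (𝓡 m) x₀ x₀) a b := by
  have h : (fun e => T ((extChartAt (𝓡 m) x₀).symm e)
      (FiberBundle.extend (EuclideanSpace ℝ (Fin m)) (frame x₀ x₀ a)
        ((extChartAt (𝓡 m) x₀).symm e))
      (FiberBundle.extend (EuclideanSpace ℝ (Fin m)) (frame x₀ x₀ b)
        ((extChartAt (𝓡 m) x₀).symm e)))
      =ᶠ[𝓝 (extChartAt (𝓡 m) x₀ x₀)] fun e => tensorRep T x₀ e a b := by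
    filter_upwards [eventually_chart_symm (eventually_mem_source (m := m) x₀)] with e he
    rw [extend_frame he, extend_frame he, tensorRep_apply]
  have hd := tensorRep_differentiableAt hT x₀
  rw [lieDerivTensor, lieTensorModel, lieDerivScalar, ← frame_vectorRep_self V x₀,
    mfderiv_frame (mdifferentiableAt_tensor_extend hT _ _), h.fderiv_eq,
    fderiv_clm_apply_const (θ := fun e => tensorRep T x₀ e a)
      (hd.clm_apply (differentiableAt_const _)), fderiv_clm_apply_const hd, mlieBracket_extend,
    mlieBracket_extend, tensorRep_self, tensorRep_self, map_neg, map_neg, neg_apply,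
    sub_neg_eq_add, sub_neg_eq_add]

end Charts

/-! ### The differential of a map in charts -/

section Naturality

variable {n k : ℕ}
  {N : Type*} [TopologicalSpace N] [ChartedSpace (EuclideanSpace ℝ (Fin n)) N]
  [IsManifold (𝓡 n) ∞ N]
  {M : Type*} [TopologicalSpace M] [ChartedSpace (EuclideanSpace ℝ (Fin k)) M]
  [IsManifold (𝓡 k) ∞ M]

/-- In the preferred charts, the differential of `φ` is the derivative of its representative. -/
theorem eventually_mfderiv_frame {φ : N → M} (hφ : ContMDiff (𝓡 n) (𝓡 k) ∞ φ) (p : N) :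
    ∀ᶠ u in 𝓝 (extChartAt (𝓡 n) p p), ∀ a,
      mfderiv (𝓡 n) (𝓡 k) φ ((extChartAt (𝓡 n) p).symm u)
        (frame p ((extChartAt (𝓡 n) p).symm u) a) =
      frame (φ p) (φ ((extChartAt (𝓡 n) p).symm u))
        (fderiv ℝ (writtenInExtChartAt (𝓡 n) (𝓡 k) p φ) u a) := by
  filter_upwards [eventually_chart_symm (eventually_mem_source (m := n) p),
    eventually_chart_symm (hφ.continuous.continuousAt.eventually (eventually_mem_source (m := k) (φ p))),
    extChartAt_target_mem_nhds (I := 𝓡 n) p] with u hu hu' hut a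
  have h1 : HasMFDerivAt 𝓘(ℝ, EuclideanSpace ℝ (Fin n)) (𝓡 n) (extChartAt (𝓡 n) p).symm u
      (frame p ((extChartAt (𝓡 n) p).symm u)) := by
    rw [frame_eq hu, (extChartAt (𝓡 n) p).right_inv hut]
    have := (mdifferentiableWithinAt_extChartAt_symm hut).hasMFDerivWithinAt
    simp only [ModelWithCorners.range_eq_univ, hasMFDerivWithinAt_univ] at this ⊢
    exact this
  have h2 := (hφ.mdifferentiable (by simp) ((extChartAt (𝓡 n) p).symm u)).hasMFDerivAt
  have h3 := (mdifferentiableAt_extChartAt (I := 𝓡 k) hu').hasMFDerivAt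
  rw [← coframe_eq hu'] at h3
  have h21 : HasMFDerivAt 𝓘(ℝ, EuclideanSpace ℝ (Fin n)) (𝓡 k) (φ ∘ (extChartAt (𝓡 n) p).symm) u
      (ContinuousLinearMap.comp (mfderiv (𝓡 n) (𝓡 k) φ ((extChartAt (𝓡 n) p).symm u))
        (frame p ((extChartAt (𝓡 n) p).symm u))) := HasMFDerivAt.comp u h2 h1
  have h321 : HasMFDerivAt 𝓘(ℝ, EuclideanSpace ℝ (Fin n)) 𝓘(ℝ, EuclideanSpace ℝ (Fin k))
      (extChartAt (𝓡 k) (φ p) ∘ φ ∘ (extChartAt (𝓡 n) p).symm) u _ := HasMFDerivAt.comp u h3 h21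
  -- The chain rule gives `Df = coframe ∘ dφ ∘ frame` at `u`; applying `frame` on the target side
  -- cancels `coframe`.
  exact ((congrArg (frame (φ p) (φ ((extChartAt (𝓡 n) p).symm u)))
    (DFunLike.congr_fun (mfderiv_eq_fderiv.symm.trans h321.mfderiv) a)).trans
    (frame_coframe hu' _)).symm

omit [IsManifold (𝓡 n) ∞ N] [IsManifold (𝓡 k) ∞ M] in
theorem eventually_chart_symm_written {φ : N → M} {p : N} (hφ : ContinuousAt φ p) :
    ∀ᶠ u in 𝓝 (extChartAt (𝓡 n) p p),
      (extChartAt (𝓡 k) (φ p)).symm (writtenInExtChartAt (𝓡 n) (𝓡 k) p φ u) =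
        φ ((extChartAt (𝓡 n) p).symm u) := by
  filter_upwards [eventually_chart_symm (hφ.eventually (extChartAt_source_mem_nhds (I := 𝓡 k) (φ p)))]
    with u hu
  exact (extChartAt (𝓡 k) (φ p)).left_inv hu

omit [IsManifold (𝓡 n) ∞ N] [IsManifold (𝓡 k) ∞ M] in
theorem written_self (φ : N → M) (p : N) :
    writtenInExtChartAt (𝓡 n) (𝓡 k) p φ (extChartAt (𝓡 n) p p) = extChartAt (𝓡 k) (φ p) (φ p) := by
  simp only [writtenInExtChartAt, Function.comp_apply, extChartAt_to_inv]

omit [IsManifold (𝓡 n) ∞ N] [IsManifold (𝓡 k) ∞ M] in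
theorem written_contDiffAt {φ : N → M} (hφ : ContMDiff (𝓡 n) (𝓡 k) ∞ φ) (p : N) :
    ContDiffAt ℝ 2 (writtenInExtChartAt (𝓡 n) (𝓡 k) p φ) (extChartAt (𝓡 n) p p) := by
  have h := (contMDiffAt_iff.1 (hφ p)).2
  rw [ModelWithCorners.range_eq_univ, contDiffWithinAt_univ] at h
  exact h.of_le (by norm_cast)

/-- In the preferred charts, the differential of `φ` at `p` is the derivative of its
representative. -/
theorem mfderiv_frame_self {φ : N → M} (hφ : ContMDiff (𝓡 n) (𝓡 k) ∞ φ) (p : N)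
    (a : EuclideanSpace ℝ (Fin n)) :
    mfderiv (𝓡 n) (𝓡 k) φ p (frame p p a) = frame (φ p) (φ p)
      (fderiv ℝ (writtenInExtChartAt (𝓡 n) (𝓡 k) p φ) (extChartAt (𝓡 n) p p) a) := by
  have h := (eventually_mfderiv_frame hφ p).self_of_nhds a
  rwa [extChartAt_to_inv] at h

end Naturality

/-! ### Bilinearity, symmetry and the transverse splitting -/

section Bilinear

variable {E F : Type*} [NormedAddCommGroup E] [NormedSpace ℝ E]
  [NormedAddCommGroup F] [NormedSpace ℝ F]

theorem lieTensorModel_add_smul (V : E → E) (T : E → E →L[ℝ] E →L[ℝ] ℝ) (x a a' b b' : E)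
    (c d : ℝ) : lieTensorModel V T x (a + c • a') (b + d • b') =
      lieTensorModel V T x a b + d * lieTensorModel V T x a b' + c * lieTensorModel V T x a' b
        + c * d * lieTensorModel V T x a' b' := by
  simp only [lieTensorModel, map_add, map_smul, add_apply, smul_apply, smul_eq_mul]
  ring

/-- The coefficient derivative inherits the symmetry of `T` because it is the derivative of the
scalar function `y ↦ T y a b`. -/
theorem lieTensorModel_symm {V : E → E} {T : E → E →L[ℝ] E →L[ℝ] ℝ} {x : E}
    (hT : DifferentiableAt ℝ T x) (h : ∀ y v w, T y v w = T y w v) (v w : E) :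
    lieTensorModel V T x v w = lieTensorModel V T x w v := by
  have hd (a b : E) : fderiv ℝ T x (V x) a b = fderiv ℝ (fun y => T y a b) x (V x) := by
    rw [fderiv_clm_apply_const (θ := fun y => T y a)
      (hT.clm_apply (differentiableAt_const a)) b, fderiv_clm_apply_const hT a]
  simp only [lieTensorModel, hd, h x _ v, h _ w v, h x w]
  ring

/-- A vector transverse to a hyperplane spans, together with it, the whole space. -/
theorem exists_eq_add_smul_of_transverse [FiniteDimensional ℝ E] [FiniteDimensional ℝ F]
    (hdim : Module.finrank ℝ F = Module.finrank ℝ E + 1) {L : E →L[ℝ] F}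
    (hL : Function.Injective L) {z : F} (hz : ∀ v, L v ≠ z) (w : F) :
    ∃ (v : E) (c : ℝ), w = L v + c • z := by
  have hinj : Function.Injective (L.toLinearMap.coprod (LinearMap.toSpanSingleton ℝ F z)) := by
    rw [injective_iff_map_eq_zero]
    rintro ⟨v, c⟩ h
    simp only [LinearMap.coprod_apply, LinearMap.toSpanSingleton_apply,
      ContinuousLinearMap.coe_coe] at h
    have hc : c = 0 := by
      by_contra hc
      -- From `L v + c z = 0` with `c ≠ 0`, solving for `z` would put it in the range of `L`.
      refine hz (-c⁻¹ • v) ?_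
      rw [map_smul, eq_neg_of_add_eq_zero_left h, smul_neg, neg_smul, neg_neg, smul_smul,
        inv_mul_cancel₀ hc, one_smul]
    subst hc
    rw [zero_smul, add_zero] at h
    rw [hL (h.trans (map_zero L).symm)]
    rfl
  obtain ⟨⟨v, c⟩, h⟩ := (LinearMap.injective_iff_surjective_of_finrank_eq_finrank
    (by rw [Module.finrank_prod, Module.finrank_self, hdim])).1 hinj w
  exact ⟨v, c, h.symm⟩

end Bilinear

/-! ### Pull-back relations between chart representatives -/

section Pullback

variable {n k : ℕ}
  {N : Type*} [TopologicalSpace N] [ChartedSpace (EuclideanSpace ℝ (Fin n)) N]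
  [IsManifold (𝓡 n) ∞ N]
  {M : Type*} [TopologicalSpace M] [ChartedSpace (EuclideanSpace ℝ (Fin k)) M]
  [IsManifold (𝓡 k) ∞ M]

omit [IsManifold (𝓡 n) ∞ N] in
theorem frame_vectorRep_written {φ : N → M} (hφ : ContMDiff (𝓡 n) (𝓡 k) ∞ φ) (p : N)
    (Z : Π x : M, TangentSpace (𝓡 k) x) :
    ∀ᶠ u in 𝓝 (extChartAt (𝓡 n) p p),
      frame (φ p) (φ ((extChartAt (𝓡 n) p).symm u))
        (vectorRep Z (φ p) (writtenInExtChartAt (𝓡 n) (𝓡 k) p φ u)) =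
          Z (φ ((extChartAt (𝓡 n) p).symm u)) := by
  filter_upwards [eventually_chart_symm (hφ.continuous.continuousAt.eventually
      (eventually_mem_source (m := k) (φ p))),
    eventually_chart_symm_written (k := k) hφ.continuous.continuousAt] with u hu h
  rw [vectorRep, h, frame_coframe hu]

/-- The relation is needed on a neighbourhood, not just at `p`, because it is going to be
differentiated. -/
theorem vectorRep_related {φ : N → M} (hφ : ContMDiff (𝓡 n) (𝓡 k) ∞ φ) (p : N)
    {ξ : Π q : N, TangentSpace (𝓡 n) q} {η : Π x : M, TangentSpace (𝓡 k) x}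
    (h : ∀ q, η (φ q) = mfderiv (𝓡 n) (𝓡 k) φ q (ξ q)) :
    ∀ᶠ u in 𝓝 (extChartAt (𝓡 n) p p),
      vectorRep η (φ p) (writtenInExtChartAt (𝓡 n) (𝓡 k) p φ u) =
        fderiv ℝ (writtenInExtChartAt (𝓡 n) (𝓡 k) p φ) u (vectorRep ξ p u) := by
  filter_upwards [eventually_chart_symm (eventually_mem_source (m := n) p),
    eventually_chart_symm (hφ.continuous.continuousAt.eventually
      (eventually_mem_source (m := k) (φ p))),
    eventually_chart_symm_written (k := k) hφ.continuous.continuousAt,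
    eventually_mfderiv_frame hφ p] with u hu hu' hs hm
  rw [vectorRep, hs, h, ← coframe_frame hu' (fderiv ℝ _ u _), ← hm, vectorRep, frame_coframe hu]

theorem tensorRep_pullback {φ : N → M} (hφ : ContMDiff (𝓡 n) (𝓡 k) ∞ φ) (p : N)
    {T : Π x : M, TangentSpace (𝓡 k) x →L[ℝ] TangentSpace (𝓡 k) x →L[ℝ] ℝ}
    {S : Π q : N, TangentSpace (𝓡 n) q →L[ℝ] TangentSpace (𝓡 n) q →L[ℝ] ℝ}
    (h : ∀ q v w, T (φ q) (mfderiv (𝓡 n) (𝓡 k) φ q v) (mfderiv (𝓡 n) (𝓡 k) φ q w) = S q v w) :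
    ∀ᶠ u in 𝓝 (extChartAt (𝓡 n) p p), ∀ v w, tensorRep S p u v w =
      tensorRep T (φ p) (writtenInExtChartAt (𝓡 n) (𝓡 k) p φ u)
        (fderiv ℝ (writtenInExtChartAt (𝓡 n) (𝓡 k) p φ) u v)
        (fderiv ℝ (writtenInExtChartAt (𝓡 n) (𝓡 k) p φ) u w) := by
  filter_upwards [eventually_chart_symm_written (k := k) hφ.continuous.continuousAt,
    eventually_mfderiv_frame hφ p] with u hs hm v w
  rw [tensorRep_apply, tensorRep_apply, hs, ← hm, ← hm, h]

/-- The hypothesis is local because `Z` is only a local extension of the rigging. -/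
theorem covectorRep_pullback {φ : N → M} (hφ : ContMDiff (𝓡 n) (𝓡 k) ∞ φ) (p : N)
    {T : Π x : M, TangentSpace (𝓡 k) x →L[ℝ] TangentSpace (𝓡 k) x →L[ℝ] ℝ}
    {Z : Π x : M, TangentSpace (𝓡 k) x} {θ : Π q : N, TangentSpace (𝓡 n) q →L[ℝ] ℝ}
    (h : ∀ᶠ q in 𝓝 p, ∀ v, T (φ q) (Z (φ q)) (mfderiv (𝓡 n) (𝓡 k) φ q v) = θ q v) :
    ∀ᶠ u in 𝓝 (extChartAt (𝓡 n) p p), ∀ v, covectorRep θ p u v =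
      tensorRep T (φ p) (writtenInExtChartAt (𝓡 n) (𝓡 k) p φ u)
        (vectorRep Z (φ p) (writtenInExtChartAt (𝓡 n) (𝓡 k) p φ u))
        (fderiv ℝ (writtenInExtChartAt (𝓡 n) (𝓡 k) p φ) u v) := by
  filter_upwards [eventually_chart_symm_written (k := k) hφ.continuous.continuousAt,
    eventually_mfderiv_frame hφ p, frame_vectorRep_written hφ p Z,
    eventually_chart_symm h] with u hs hm hZ hu v
  rw [tensorRep_apply, covectorRep_apply, hs, ← hm, hZ, hu]

omit [IsManifold (𝓡 n) ∞ N] in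
theorem scalar_pullback {φ : N → M} (hφ : ContMDiff (𝓡 n) (𝓡 k) ∞ φ) (p : N)
    {T : Π x : M, TangentSpace (𝓡 k) x →L[ℝ] TangentSpace (𝓡 k) x →L[ℝ] ℝ}
    {Z : Π x : M, TangentSpace (𝓡 k) x} {r : N → ℝ}
    (h : ∀ᶠ q in 𝓝 p, T (φ q) (Z (φ q)) (Z (φ q)) = r q) :
    ∀ᶠ u in 𝓝 (extChartAt (𝓡 n) p p), r ((extChartAt (𝓡 n) p).symm u) =
      tensorRep T (φ p) (writtenInExtChartAt (𝓡 n) (𝓡 k) p φ u)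
        (vectorRep Z (φ p) (writtenInExtChartAt (𝓡 n) (𝓡 k) p φ u))
        (vectorRep Z (φ p) (writtenInExtChartAt (𝓡 n) (𝓡 k) p φ u)) := by
  filter_upwards [eventually_chart_symm_written (k := k) hφ.continuous.continuousAt,
    frame_vectorRep_written hφ p Z, eventually_chart_symm h] with u hs hZ hu
  rw [tensorRep_apply, hs, hZ, hu]

end Pullback

/-! ### Vanishing of the deformation tensor -/

section Horizon

variable {n : ℕ}
  {N : Type*} [TopologicalSpace N] [ChartedSpace (EuclideanSpace ℝ (Fin n)) N]
  [IsManifold (𝓡 n) ∞ N]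
  {M : Type*} [TopologicalSpace M] [ChartedSpace (EuclideanSpace ℝ (Fin (n + 1))) M]
  [IsManifold (𝓡 (n + 1)) ∞ M]
  {D : NullHypersurfaceData n N} {g : LorentzianMetric (n + 1) M} {φ : N → M}
  {ζ : Π p : N, TangentSpace (𝓡 (n + 1)) (φ p)}

/-- If `dφ(v) = 0`, then `γ(v, ·)` and `ℓ(v)` vanish, so `(v, 0)` lies in the radical of the
non-degenerate form `𝒜`. -/
theorem IsEmbedded.mfderiv_injective (h : IsEmbedded D g φ ζ) (p : N) {v : TangentSpace (𝓡 n) p}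
    (hv : mfderiv (𝓡 n) (𝓡 (n + 1)) φ p v = 0) : v = 0 := by
  refine (D.nondegenerate p v 0 fun Z b => ?_).1
  rw [← h.pullback_γ, ← h.pullback_ℓ p v, hv]
  simp

variable {ηbar : Π p : N, TangentSpace (𝓡 n) p} {O : Set M}
  {η : Π x : M, TangentSpace (𝓡 (n + 1)) x}

theorem IsKillingHorizonZero.deformationTensor_eq_zero
    (h : IsKillingHorizonZero D ηbar g φ ζ O η) (p : N) (v w : TangentSpace (𝓡 (n + 1)) (φ p)) :
    deformationTensor g η (φ p) v w = 0 := by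
  have hφ := h.embedded.isSmoothEmbedding.contMDiff
  obtain ⟨Z, ⟨U, hU, hpU, hZ, hZζ⟩, hζζ, hζv⟩ := h.lieDeriv_rigging p
  have hZζ' : ∀ᶠ q in 𝓝 p, Z (φ q) = ζ q :=
    (hφ.continuous.continuousAt.eventually (hU.mem_nhds hpU)).mono hZζ
  have hx := written_self (n := n) (k := n + 1) φ p
  have hf := written_contDiffAt (n := n) (k := n + 1) hφ p
  have hξd := vectorRep_differentiableAt h.abstractHorizon.smooth (x₀ := p) Filter.univ_mem
  have hηd := vectorRep_differentiableAt h.smooth (x₀ := φ p)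
    (h.isOpen.mem_nhds (h.range_subset (mem_range_self p)))
  have hZd := vectorRep_differentiableAt hZ (x₀ := φ p) (hU.mem_nhds hpU)
  have hgd := tensorRep_differentiableAt g.smooth (φ p)
  have hrel := vectorRep_related hφ p h.extends_generator
  have hZ0 : frame (φ p) (φ p) (vectorRep Z (φ p) (extChartAt (𝓡 (n + 1)) (φ p) (φ p))) = ζ p := by
    rw [frame_vectorRep_self, hZζ p hpU]
  have hgsymm : ∀ y v w, tensorRep g.inner (φ p) y v w = tensorRep g.inner (φ p) y w v :=
    fun y v w => g.symm _ _ _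
  set f := writtenInExtChartAt (𝓡 n) (𝓡 (n + 1)) p φ
  set x := extChartAt (𝓡 n) p p with hxdef
  set Df := fderiv ℝ f x with hDf
  set z := vectorRep Z (φ p) (extChartAt (𝓡 (n + 1)) (φ p) (φ p)) with hz
  have hmf : ∀ a, mfderiv (𝓡 n) (𝓡 (n + 1)) φ p (frame p p a) = frame (φ p) (φ p) (Df a) :=
    mfderiv_frame_self hφ p
  set K := lieTensorModel (vectorRep η (φ p)) (tensorRep g.inner (φ p))
    (extChartAt (𝓡 (n + 1)) (φ p) (φ p)) with hK
  -- This turns the bracket terms of the coordinate identities into those of the horizon conditions.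
  -- Here `hx` says that the representative of `φ` sends the chart image of `p` to that of `φ p`.
  have hbr (b) : g.inner (φ p) (VectorField.mlieBracket (𝓡 (n + 1)) Z η (φ p))
      (frame (φ p) (φ p) b) = tensorRep g.inner (φ p) (f x) (VectorField.lieBracket ℝ
        (vectorRep Z (φ p)) (vectorRep η (φ p)) (f x)) b := by
    rw [hx, tensorRep_self, mlieBracket_eq]
  have hKtt : ∀ a b, K (Df a) (Df b) = 0 := fun a b => by
    rw [hK, ← hx, lieTensorModel_pullback hf hξd (hx ▸ hηd) (hx ▸ hgd)
      (tensorRep_differentiableAt D.γ_smooth p) hrel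
      (tensorRep_pullback hφ p h.embedded.pullback_γ) a b,
      ← lieDerivTensor_eq _ D.γ_smooth, h.abstractHorizon.lieDeriv_γ]
  have hKzt : ∀ b, K z (Df b) = 0 := fun b => by
    rw [hK, hz, ← hx, lieTensorModel_sub_lieCovectorModel hf hξd (hx ▸ hηd) (hx ▸ hZd) (hx ▸ hgd)
      (covectorRep_differentiableAt D.ℓ_smooth p) hrel
      (covectorRep_pullback hφ p (hZζ'.mono fun q hq v => by
        rw [hq, h.embedded.pullback_ℓ])) b,
      ← lieDerivCovector_eq _ D.ℓ_smooth, ← hbr, ← hmf, hζv, add_neg_cancel]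
  have hKzz : K z z = 0 := by
    rw [hK, hz, ← hx, lieTensorModel_self (ξ := vectorRep ηbar p)
      (hf.differentiableAt (by norm_num)) (hx ▸ hZd)
      (hx ▸ hgd) (hgsymm _) hrel.self_of_nhds
      (scalar_pullback hφ p (hZζ'.mono fun q hq => by rw [hq, h.embedded.pullback_ℓ2])),
      ← hbr, hx, ← hz, hZ0, hζζ, lieDerivScalar, ← frame_vectorRep_self ηbar p,
      mfderiv_frame ((D.ℓ2_smooth p).mdifferentiableAt (by simp))]
    ring
  have hinj : Function.Injective Df := by
    rw [injective_iff_map_eq_zero]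
    intro a ha
    have h0 := h.embedded.mfderiv_injective p (v := frame p p a) (by rw [hmf, ha, map_zero])
    rw [← coframe_frame (mem_chart_source _ p) a, h0, map_zero]
  have htr : ∀ a, Df a ≠ z := fun a ha =>
    h.embedded.rigging_transverse p (frame p p a) (by rw [hmf, ha, hZ0])
  have hspan := exists_eq_add_smul_of_transverse (by simp) hinj htr
  obtain ⟨a, c, hv⟩ := hspan (coframe (φ p) (φ p) v)
  obtain ⟨b, d, hw⟩ := hspan (coframe (φ p) (φ p) w)
  have hKs : K (Df a) z = K z (Df a) := lieTensorModel_symm hgd hgsymm _ _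
  rw [deformationTensor, ← frame_coframe (mem_chart_source _ (φ p)) v,
    ← frame_coframe (mem_chart_source _ (φ p)) w, lieDerivTensor_eq _ g.smooth, hv, hw,
    lieTensorModel_add_smul]
  -- Rewriting has exposed the coordinate formula; folding it back into `K` lets the block
  -- identities apply.
  change K _ _ + d * K _ _ + c * K _ _ + c * d * K _ _ = 0
  rw [hKs, hKtt, hKzt, hKzt, hKzz]
  ring

end Horizon
end HypersurfaceData

end

theorem proposition6p3 {n : ℕ}
    {N : Type*} [TopologicalSpace N] [T2Space N] [SecondCountableTopology N] [ConnectedSpace N]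
    [ChartedSpace (EuclideanSpace ℝ (Fin n)) N] [IsManifold (𝓡 n) ∞ N]
    {M : Type*} [TopologicalSpace M] [T2Space M] [SecondCountableTopology M] [ConnectedSpace M]
    [ChartedSpace (EuclideanSpace ℝ (Fin (n + 1))) M] [IsManifold (𝓡 (n + 1)) ∞ M]
    (D : HypersurfaceData.NullHypersurfaceData n N)
    (ηbar : Π p : N, TangentSpace (𝓡 n) p)
    (g : HypersurfaceData.LorentzianMetric (n + 1) M)
    (φ : N → M) (ζ : Π p : N, TangentSpace (𝓡 (n + 1)) (φ p))
    (O : Set M) (η : Π x : M, TangentSpace (𝓡 (n + 1)) x)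
    (h : HypersurfaceData.IsKillingHorizonZero D ηbar g φ ζ O η) :
    ∀ (p : N) (v w : TangentSpace (𝓡 (n + 1)) (φ p)),
      HypersurfaceData.deformationTensor g η (φ p) v w = 0 :=
  fun p v w => h.deformationTensor_eq_zero p v w
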